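/- Let $q,d,d',N\in\mathbb N$ and let $V$ be a (possibly infinite-dimensional) reproducing kernel Hilbert space of vector fields $\mathbb R^q\to\mathbb R^q$ with matrix-valued kernel $K$, so that $K(\cdot,z)p\in V$ and $\langle f,K(\cdot,z)p\rangle_V=\langle f(z),p\rangle$ for all $f\in V$ and $z,p\in\mathbb R^q$. Assume that $V$ is (strongly) admissible, i.e. continuously embedded in $W^{2,\infty}(\mathbb R^q,\mathbb R^q)$: there is $\kappa>0$ such that every $f\in V$ is a continuous function with weak derivatives $Df,D^2f$ satisfying $$\|f\|_\infty+\|Df\|_\infty+\|D^2f\|_\infty\le\kappa\|f\|_V .$$ Let $A\in\mathbb R^{q\times d}$, $B\in\mathbb R^{d'\times q}$, $x^1,\dots,x^N\in\mathbb R^d$ and $y^1,\dots,y^N\in\mathbb R^{d'}$. For $v\in L^2([0,1],V)$ let $F(v,x)=Bz_1$ be the output of the RKHS-FlowResNet, where $z$ is the solution of $\dot z_t=v_t(z_t)$, $z_0=Ax$, and let $L$ be the empirical risk $$L(v)=\frac1{2N}\sum_{i=1}^N\|F(v,x^i)-y^i\|^2 .$$ Differential equations are understood in the weak sense, for functions in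 $H^1([0,1],\mathbb R^q)$ (equivalently, in integrated form with square-integrable right-hand side). Then $L$ is differentiable on $L^2([0,1],V)$ and, for every $v\in L^2([0,1],V)$, the gradient of $L$ with respect to the inner product of $L^2([0,1],V)$ is $$\nabla L(v)=-\sum_{i=1}^N K(\cdot,z^i)\,p^i,\qquad\text{i.e. } \nabla L(v)_t=-\sum_{i=1}^N K(\cdot,z^i_t)\,p^i_t\ \text{ for almost every }t\in[0,1],$$ where, for each $i$, $z^i$ is the unique solution of the forward problem $$\dot z^i_t=v_t(z^i_t),\qquad z^i_0=Ax^i,$$ and $p^i$ is the unique solution of the backward (adjoint) problem $$\dot p^i_t=-Dv_t(z^i_t)^\top p^i_t,\qquad p^i_1=-\frac1N B^\top(Bz^i_1-y^i).$$ -/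

import Mathlib

open MeasureTheory Set
open scoped ContDiff

noncomputable section

namespace FlowResNet

/-- `g` is the weak (distributional) derivative of `f : E → F` in the direction `e`:
`∫ (∂ₑ φ) f = - ∫ φ g` for all test functions `φ ∈ C_c^∞(E, ℝ)`. -/
structure HasWeakDirDeriv {E F : Type*} [NormedAddCommGroup E] [NormedSpace ℝ E]
    [MeasureSpace E] [NormedAddCommGroup F] [NormedSpace ℝ F]
    (f : E → F) (e : E) (g : E → F) : Prop where
  locallyIntegrable : LocallyIntegrable f volume
  locallyIntegrable_deriv : LocallyIntegrable g volume
  integral_eq : ∀ φ : E → ℝ, ContDiff ℝ ∞ φ → HasCompactSupport φ →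
    ∫ x, (fderiv ℝ φ x e) • f x = - ∫ x, φ x • g x

/-- (Strong) admissibility of a reproducing kernel Hilbert space `V` of vector fields on `ℝ^q`:
`V` is continuously embedded in `W^{2,∞}(ℝ^q, ℝ^q)`, i.e. for some `κ > 0` every `f ∈ V` has weak
derivatives `Df` (matrix-valued, `Df z e` being the derivative of `f` in the direction `e`) and
`D²f` (with values in bilinear maps, `D²f z ![e, e']` being the derivative of `z ↦ Df z e'` in the
direction `e`) with `‖f‖_∞ + ‖Df‖_∞ + ‖D²f‖_∞ ≤ κ ‖f‖_V` (essential suprema of operator norms).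
Elements of `V` are genuine functions and elements of `W^{2,∞}` are classes modulo
almost everywhere equality; `f` is, as usual, the continuous representative of its class. -/
def IsStronglyAdmissible {q : ℕ} (V : Type*) [NormedAddCommGroup V] [InnerProductSpace ℝ V]
    [RKHS ℝ V (EuclideanSpace ℝ (Fin q)) (EuclideanSpace ℝ (Fin q))] : Prop :=
  ∃ κ : ℝ, 0 < κ ∧ ∀ f : V, Continuous (f : EuclideanSpace ℝ (Fin q) → EuclideanSpace ℝ (Fin q)) ∧
    ∃ (Df : EuclideanSpace ℝ (Fin q) →
          EuclideanSpace ℝ (Fin q) →L[ℝ] EuclideanSpace ℝ (Fin q))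
      (D2f : EuclideanSpace ℝ (Fin q) →
          EuclideanSpace ℝ (Fin q) [×2]→L[ℝ] EuclideanSpace ℝ (Fin q)),
      (∀ e, HasWeakDirDeriv (f : EuclideanSpace ℝ (Fin q) → EuclideanSpace ℝ (Fin q)) e
        (fun z => Df z e)) ∧
      (∀ e e', HasWeakDirDeriv (fun z => Df z e') e (fun z => D2f z ![e, e'])) ∧
      essSup (fun z => ‖f z‖ₑ) volume + essSup (fun z => ‖Df z‖ₑ) volume
        + essSup (fun z => ‖D2f z‖ₑ) volume ≤ ENNReal.ofReal (κ * ‖f‖)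

/-- Lebesgue measure on the time interval `[0,1]`. -/
abbrev timeMeasure : Measure ℝ := volume.restrict (Icc (0 : ℝ) 1)

/-- The space of control parameters `L²([0,1], V)`. -/
abbrev Control (V : Type*) [NormedAddCommGroup V] : Type _ := Lp V 2 timeMeasure

variable {q : ℕ} {V : Type*} [NormedAddCommGroup V] [InnerProductSpace ℝ V]
  [RKHS ℝ V (EuclideanSpace ℝ (Fin q)) (EuclideanSpace ℝ (Fin q))]

/-- `z` is an `H¹([0,1], ℝ^q)` solution of the forward problem `ż_t = v_t(z_t)`, `z_0 = z₀`:
the right-hand side is in `L²([0,1])` and `z` is its primitive starting from `z₀`.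
Only the values of `z` on `[0,1]` matter. -/
structure IsForwardSolution (v : ℝ → V) (z₀ : EuclideanSpace ℝ (Fin q))
    (z : ℝ → EuclideanSpace ℝ (Fin q)) : Prop where
  memLp : MemLp (fun t => v t (z t)) 2 timeMeasure
  eq_integral : ∀ t ∈ Icc (0 : ℝ) 1, z t = z₀ + ∫ s in (0 : ℝ)..t, v s (z s)

/-- `p` is an `H¹([0,1], ℝ^q)` solution of the backward problem
`ṗ_t = - Dv_t(z_t)ᵀ p_t`, `p_1 = p₁`: the (classical) Jacobian of `v_t` at `z_t` exists for almost
every `t`, the right-hand side is in `L²([0,1])`, and `p_t = p₁ + ∫_t^1 Dv_s(z_s)ᵀ p_s ds`.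
Only the values of `p` on `[0,1]` matter. -/
structure IsBackwardSolution (v : ℝ → V) (z : ℝ → EuclideanSpace ℝ (Fin q))
    (p₁ : EuclideanSpace ℝ (Fin q)) (p : ℝ → EuclideanSpace ℝ (Fin q)) : Prop where
  differentiableAt : ∀ᵐ t ∂timeMeasure, DifferentiableAt ℝ (⇑(v t)) (z t)
  memLp : MemLp (fun t => (fderiv ℝ (⇑(v t)) (z t)).adjoint (p t)) 2 timeMeasure
  eq_integral : ∀ t ∈ Icc (0 : ℝ) 1,
    p t = p₁ + ∫ s in t..(1 : ℝ), (fderiv ℝ (⇑(v s)) (z s)).adjoint (p s)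

open Classical in
/-- The solution of the forward problem with control `v` and initial value `z₀`
(junk value `0` if there is none). -/
def forwardFlow (v : ℝ → V) (z₀ : EuclideanSpace ℝ (Fin q)) : ℝ → EuclideanSpace ℝ (Fin q) :=
  if h : ∃ z, IsForwardSolution v z₀ z then h.choose else 0

/-- Output `F(v, x) = B z_1` of the RKHS-FlowResNet, where `z` solves the forward problem
with `z_0 = A x`. -/
def output {d d' : ℕ} (A : Matrix (Fin q) (Fin d) ℝ) (B : Matrix (Fin d') (Fin q) ℝ)
    (v : Control V) (x : EuclideanSpace ℝ (Fin d)) : EuclideanSpace ℝ (Fin d') :=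
  B.toEuclideanLin (forwardFlow (v : ℝ → V) (A.toEuclideanLin x) 1)

/-- Empirical risk `L(v) = 1/(2N) ∑ᵢ ‖F(v, xⁱ) - yⁱ‖²`. -/
def empiricalRisk {d d' N : ℕ} (A : Matrix (Fin q) (Fin d) ℝ) (B : Matrix (Fin d') (Fin q) ℝ)
    (x : Fin N → EuclideanSpace ℝ (Fin d)) (y : Fin N → EuclideanSpace ℝ (Fin d'))
    (v : Control V) : ℝ :=
  1 / (2 * (N : ℝ)) * ∑ i, ‖output A B v (x i) - y i‖ ^ 2

end FlowResNet

end

/-!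
A strongly admissible `V` consists of functions of class `C^{1,1}`, with constants controlled by the
norm of `V`: mollification turns the weak derivatives into classical derivatives of the mollified
functions, and the uniform bounds survive the limit
(`differentiable_and_lipschitz_fderiv_of_weak`). So a control `v ∈ L²([0,1], V)` gives a right-hand
side that is measurable in time and Lipschitz in space with the integrable constant `κ ‖v_t‖`. The
forward and backward problems are then well posed by a Picard iteration in a weighted supremum norm
(`exists_eq_add_integral`) and a Grönwall inequality (`le_of_le_add_integral_mul`). The same
inequality shows that the trajectory depends on the control in a Lipschitz way
(`HasRegularFields.norm_sub_le_integral_norm_sub`).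

The gradient is obtained without linearising the flow. Let `z` and `ζ` be the trajectories of two
controls `v` and `w` with the same initial value, and let `p` solve the adjoint problem along `z`.
Integrating `d/dt ⟨p, ζ - z⟩` over `[0,1]`, the adjoint equation removes the linear term
`⟨p, Dv(z) (ζ - z)⟩`, which leaves
`⟨p_1, ζ_1 - z_1⟩ = ∫ ⟨p, (w - v)(z)⟩ + O(‖w - v‖²)`
(`HasRegularFields.abs_inner_sub_integral_inner_le`). By the reproducing property the integral is
the `L²([0,1], V)` inner product of `t ↦ K(·, z_t) p_t` with `w - v`. As the terminal value of `p^i`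
is minus the derivative of the `i`-th term of the risk with respect to the endpoint of the
trajectory, expanding the squares in the risk gives the gradient, with a quadratic remainder
(`HasRegularFields.hasGradientAt_empiricalRisk`).
-/

open MeasureTheory Set
open scoped ContDiff

namespace FlowResNet

/-! ### From bounded weak derivatives to classical regularity -/

section WeakDerivatives

open Filter Topology Convolution

variable {E F : Type*} [NormedAddCommGroup E] [InnerProductSpace ℝ E] [FiniteDimensional ℝ E]
  [MeasurableSpace E] [BorelSpace E] [NormedAddCommGroup F] [NormedSpace ℝ F]

/-- Mollification commutes with weak derivatives: the classical directional derivatives of `φ ⋆ f`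
are the mollified weak derivatives of `f`. -/
theorem HasWeakDirDeriv.exists_hasFDerivAt_convolution
    {f : E → F} {G : E → E → F} (h : ∀ e, HasWeakDirDeriv f e (G e))
    {φ : E → ℝ} (hφ : ContDiff ℝ ∞ φ) (hc : HasCompactSupport φ) (x : E) :
    ∃ D : E →L[ℝ] F, HasFDerivAt (φ ⋆[ContinuousLinearMap.lsmul ℝ ℝ, volume] f) D x ∧
      ∀ e, D e = (φ ⋆[ContinuousLinearMap.lsmul ℝ ℝ, volume] (G e)) x := by
  have hf : LocallyIntegrable f volume := (h 0).locallyIntegrable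
  have hφ1 : ContDiff ℝ 1 φ := hφ.of_le (by norm_cast)
  refine ⟨_, hc.hasFDerivAt_convolution_left (ContinuousLinearMap.lsmul ℝ ℝ) hφ1 hf x, fun e => ?_⟩
  have hex := (hc.fderiv ℝ).convolutionExists_left
    ((ContinuousLinearMap.lsmul ℝ ℝ : ℝ →L[ℝ] F →L[ℝ] F).precompL E)
    (hφ1.continuous_fderiv one_ne_zero) hf x
  have hex' := hex.integrable_swap
  rw [convolution_eq_swap, ContinuousLinearMap.integral_apply hex', convolution_lsmul_swap]
  -- The test function is the reflected translate `t ↦ φ (x - t)`.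
  have hψ : ContDiff ℝ ∞ (fun t => φ (x - t)) := hφ.comp (contDiff_const.sub contDiff_id)
  have hψc : HasCompactSupport (fun t => φ (x - t)) :=
    hc.comp_homeomorph (Homeomorph.subLeft x)
  have key := (h e).integral_eq _ hψ hψc
  have hd : ∀ t, fderiv ℝ (fun t => φ (x - t)) t e = - fderiv ℝ φ (x - t) e := by
    intro t
    have h1 : HasFDerivAt (fun t : E => x - t) (-ContinuousLinearMap.id ℝ E) t := by
      simpa using (hasFDerivAt_id t).const_sub x
    have h2 : HasFDerivAt φ (fderiv ℝ φ (x - t)) (x - t) :=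
      ((hφ1.differentiable one_ne_zero) _).hasFDerivAt
    have h3 : HasFDerivAt (fun t => φ (x - t)) _ t := h2.comp t h1
    rw [h3.fderiv]
    simp
  simp only [hd, neg_smul, integral_neg, neg_inj] at key
  rw [← key]
  simp

theorem norm_convolution_le_of_ae_bound {φ : E → ℝ} (hφ : Continuous φ) (hc : HasCompactSupport φ)
    (h0 : ∀ x, 0 ≤ φ x) (h1 : ∫ x, φ x = 1) {g : E → F} {C : ℝ} (hg : ∀ᵐ x, ‖g x‖ ≤ C) (x : E) :
    ‖(φ ⋆[ContinuousLinearMap.lsmul ℝ ℝ, volume] g) x‖ ≤ C := by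
  rw [convolution_lsmul_swap]
  have hi : Integrable (fun t => φ (x - t) * C) :=
    ((hφ.integrable_of_hasCompactSupport hc).comp_sub_left x).mul_const C
  calc ‖∫ t, φ (x - t) • g t‖ ≤ ∫ t, φ (x - t) * C := by
        refine norm_integral_le_of_norm_le hi ?_
        filter_upwards [hg] with t ht
        rw [norm_smul, Real.norm_of_nonneg (h0 _)]
        exact mul_le_mul_of_nonneg_left ht (h0 _)
    _ = C := by
        rw [integral_mul_const, integral_sub_left_eq_self φ volume x, h1, one_mul]

/-- A continuous function whose first and second weak derivatives are essentially bounded is of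
class `C^{1,1}`. The mollified functions satisfy the claimed bounds and a second order Taylor
estimate uniformly; their derivatives at a point stay in a compact ball, and any cluster point of
them is the derivative of the limit. -/
theorem differentiable_and_lipschitz_fderiv_of_weak [FiniteDimensional ℝ F]
    {f : E → F} (hf : Continuous f) {G : E → E → F} {H : E → E → E → F} {C₁ C₂ : ℝ}
    (hC₁ : 0 ≤ C₁) (hC₂ : 0 ≤ C₂)
    (hG : ∀ e, HasWeakDirDeriv f e (G e)) (hH : ∀ e e', HasWeakDirDeriv (G e') e (H e e'))
    (bG : ∀ e, ∀ᵐ x, ‖G e x‖ ≤ C₁ * ‖e‖) (bH : ∀ e e', ∀ᵐ x, ‖H e e' x‖ ≤ C₂ * ‖e'‖ * ‖e‖) :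
    Differentiable ℝ f ∧ (∀ x, ‖fderiv ℝ f x‖ ≤ C₁) ∧
      ∀ x y, ‖fderiv ℝ f x - fderiv ℝ f y‖ ≤ C₂ * ‖x - y‖ := by
  let φ : ℕ → ContDiffBump (0 : E) := fun n =>
    ⟨1 / ((n : ℝ) + 1) / 2, 1 / ((n : ℝ) + 1), by positivity, half_lt_self (by positivity)⟩
  have hφlim : Tendsto (fun n => (φ n).rOut) atTop (𝓝 0) := tendsto_one_div_add_atTop_nhds_zero_nat
  set ψ : ℕ → E → ℝ := fun n => (φ n).normed volume with hψ
  have ψs : ∀ n, ContDiff ℝ ∞ (ψ n) := fun n => (φ n).contDiff_normed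
  have ψc : ∀ n, HasCompactSupport (ψ n) := fun n => (φ n).hasCompactSupport_normed
  have ψ0 : ∀ n x, 0 ≤ ψ n x := fun n x => (φ n).nonneg_normed x
  have ψ1 : ∀ n, ∫ x, ψ n x = 1 := fun n => (φ n).integral_normed
  have hbound : ∀ n (g : E → F) (C : ℝ), (∀ᵐ x, ‖g x‖ ≤ C) → ∀ x,
      ‖(ψ n ⋆[ContinuousLinearMap.lsmul ℝ ℝ, volume] g) x‖ ≤ C := fun n g C hg x =>
    norm_convolution_le_of_ae_bound (ψs n).continuous (ψc n) (ψ0 n) (ψ1 n) hg x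
  choose D hD hDe using fun n x =>
    HasWeakDirDeriv.exists_hasFDerivAt_convolution hG (ψs n) (ψc n) x
  have D1 : ∀ n x, ‖D n x‖ ≤ C₁ := fun n x =>
    ContinuousLinearMap.opNorm_le_bound _ hC₁ fun e => by
      rw [hDe]; exact hbound n _ _ (bG e) x
  have D2 : ∀ n x y, ‖D n x - D n y‖ ≤ C₂ * ‖x - y‖ := by
    intro n x y
    refine ContinuousLinearMap.opNorm_le_bound _ (by positivity) fun e' => ?_
    choose D' hD' hDe' using fun x =>
      HasWeakDirDeriv.exists_hasFDerivAt_convolution (fun e => hH e e') (ψs n) (ψc n) x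
    have hb : ∀ x, ‖D' x‖ ≤ C₂ * ‖e'‖ := fun x =>
      ContinuousLinearMap.opNorm_le_bound _ (by positivity) fun e => by
        rw [hDe']; exact hbound n _ _ (bH e e') x
    have := convex_univ.norm_image_sub_le_of_norm_hasFDerivWithin_le
      (fun x _ => (hD' x).hasFDerivWithinAt) (fun x _ => hb x) (mem_univ y) (mem_univ x)
    rw [_root_.sub_apply, hDe, hDe]
    linarith
  have taylor : ∀ n x y, ‖(ψ n ⋆[ContinuousLinearMap.lsmul ℝ ℝ, volume] f) y
      - (ψ n ⋆[ContinuousLinearMap.lsmul ℝ ℝ, volume] f) x - D n x (y - x)‖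
        ≤ C₂ * ‖y - x‖ * ‖y - x‖ := by
    intro n x y
    refine (convex_segment x y).norm_image_sub_le_of_norm_hasFDerivWithin_le'
      (fun z _ => (hD n z).hasFDerivWithinAt) (fun z hz => ?_)
      (left_mem_segment ℝ x y) (right_mem_segment ℝ x y)
    exact (D2 n z x).trans (mul_le_mul_of_nonneg_left (norm_sub_le_of_mem_segment hz) hC₂)
  have conv : ∀ x, Tendsto (fun n => (ψ n ⋆[ContinuousLinearMap.lsmul ℝ ℝ, volume] f) x)
      atTop (𝓝 (f x)) := fun x =>
    ContDiffBump.convolution_tendsto_right_of_continuous hφlim hf x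
  -- Passing to an ultrafilter makes the derivatives converge at all points simultaneously.
  let U : Ultrafilter ℕ := Ultrafilter.of atTop
  have hU : (U : Filter ℕ) ≤ atTop := Ultrafilter.of_le atTop
  have : ∀ x, ∃ T : E →L[ℝ] F, Tendsto (fun n => D n x) U (𝓝 T) := by
    intro x
    have : ProperSpace (E →L[ℝ] F) := FiniteDimensional.proper ℝ _
    obtain ⟨T, -, hT⟩ := (isCompact_closedBall (0 : E →L[ℝ] F) C₁).ultrafilter_le_nhds
      (U.map fun n => D n x) (by
        simp only [le_principal_iff, Ultrafilter.coe_map, mem_map]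
        exact Filter.univ_mem' fun n => by simpa using D1 n x)
    exact ⟨T, hT⟩
  choose T hT using this
  have hder : ∀ x, HasFDerivAt f (T x) x := by
    intro x
    refine HasFDerivAt.of_isLittleO ?_
    have hO : (fun y => f y - f x - T x (y - x)) =O[𝓝 x] fun y => ‖y - x‖ ^ 2 := by
      refine Asymptotics.IsBigO.of_bound C₂ (Eventually.of_forall fun y => ?_)
      have hlim : Tendsto (fun n => ‖(ψ n ⋆[ContinuousLinearMap.lsmul ℝ ℝ, volume] f) y
          - (ψ n ⋆[ContinuousLinearMap.lsmul ℝ ℝ, volume] f) x - D n x (y - x)‖) U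
          (𝓝 ‖f y - f x - T x (y - x)‖) :=
        ((((conv y).mono_left hU).sub ((conv x).mono_left hU)).sub
          ((ContinuousLinearMap.apply ℝ F (y - x)).continuous.tendsto _ |>.comp (hT x))).norm
      refine (le_of_tendsto' hlim fun n => taylor n x y).trans_eq ?_
      rw [Real.norm_of_nonneg (by positivity)]; ring
    exact hO.trans_isLittleO (Asymptotics.isLittleO_norm_pow_id one_lt_two |>.comp_tendsto
      (tendsto_sub_nhds_zero_iff.2 tendsto_id))
  refine ⟨fun x => (hder x).differentiableAt, fun x => ?_, fun x y => ?_⟩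
  · rw [(hder x).fderiv]
    exact le_of_tendsto' (hT x).norm fun n => D1 n x
  · rw [(hder x).fderiv, (hder y).fderiv]
    exact le_of_tendsto' ((hT x).sub (hT y)).norm fun n => D2 n x y

end WeakDerivatives

/-! ### Regularity of the vector fields of an admissible space -/

section RegularFields

variable {q : ℕ} {V : Type*} [NormedAddCommGroup V] [InnerProductSpace ℝ V]
  [RKHS ℝ V (EuclideanSpace ℝ (Fin q)) (EuclideanSpace ℝ (Fin q))]

/-- The classical form of strong admissibility: every `f ∈ V` is of class `C^{1,1}`, and its
supremum norm, the supremum norm of its derivative and the Lipschitz constant of its derivative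
are at most `κ ‖f‖`. -/
structure HasRegularFields (V : Type*) [NormedAddCommGroup V] [InnerProductSpace ℝ V]
    [RKHS ℝ V (EuclideanSpace ℝ (Fin q)) (EuclideanSpace ℝ (Fin q))] (κ : ℝ) : Prop where
  nonneg : 0 ≤ κ
  norm_le : ∀ (f : V) z, ‖f z‖ ≤ κ * ‖f‖
  differentiable : ∀ f : V, Differentiable ℝ f
  norm_fderiv_le : ∀ (f : V) z, ‖fderiv ℝ f z‖ ≤ κ * ‖f‖
  norm_fderiv_sub_le : ∀ (f : V) z z', ‖fderiv ℝ f z - fderiv ℝ f z'‖ ≤ κ * ‖f‖ * ‖z - z'‖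

theorem IsStronglyAdmissible.exists_hasRegularFields (hV : IsStronglyAdmissible V) :
    ∃ κ, HasRegularFields V κ := by
  obtain ⟨κ, hκ, H⟩ := hV
  have toReal : ∀ {G : Type _} [NormedAddCommGroup G] (g : EuclideanSpace ℝ (Fin q) → G) {C : ℝ},
      0 ≤ C → essSup (fun z => ‖g z‖ₑ) volume ≤ ENNReal.ofReal C → ∀ᵐ z, ‖g z‖ ≤ C := by
    intro G _ g C hC h
    filter_upwards [ENNReal.ae_le_essSup (μ := volume) fun z => ‖g z‖ₑ] with z hz
    have := hz.trans h
    rwa [← ofReal_norm, ENNReal.ofReal_le_ofReal_iff hC] at this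
  have main : ∀ f : V, (∀ z, ‖f z‖ ≤ κ * ‖f‖) ∧ Differentiable ℝ f ∧
      (∀ z, ‖fderiv ℝ f z‖ ≤ κ * ‖f‖) ∧
      ∀ z z', ‖fderiv ℝ f z - fderiv ℝ f z'‖ ≤ κ * ‖f‖ * ‖z - z'‖ := by
    intro f
    obtain ⟨hc, Df, D2f, h1, h2, hb⟩ := H f
    have hC : 0 ≤ κ * ‖f‖ := by positivity
    have b0 := toReal _ hC ((le_self_add.trans le_self_add).trans hb)
    have b1 := toReal Df hC ((le_add_self.trans le_self_add).trans hb)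
    have b2 := toReal D2f hC (le_add_self.trans hb)
    refine ⟨fun z => ?_, differentiable_and_lipschitz_fderiv_of_weak hc hC hC h1 h2
      (fun e => ?_) (fun e e' => ?_)⟩
    · have hd := Measure.dense_of_ae b0
      have hcl : IsClosed {z | ‖f z‖ ≤ κ * ‖f‖} := isClosed_le hc.norm continuous_const
      have : z ∈ closure {z | ‖f z‖ ≤ κ * ‖f‖} := hd z
      rwa [hcl.closure_eq] at this
    · filter_upwards [b1] with z hz
      exact (Df z).le_of_opNorm_le hz e
    · filter_upwards [b2] with z hz
      refine ((D2f z).le_of_opNorm_le hz _).trans_eq ?_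
      simp [Fin.prod_univ_two]; ring
  exact ⟨κ, hκ.le, fun f => (main f).1, fun f => (main f).2.1, fun f => (main f).2.2.1,
    fun f => (main f).2.2.2⟩

namespace HasRegularFields

variable {κ : ℝ} (hκ : HasRegularFields V κ)
include hκ

theorem norm_apply_sub_le (f : V) (z z' : EuclideanSpace ℝ (Fin q)) :
    ‖f z - f z'‖ ≤ κ * ‖f‖ * ‖z - z'‖ :=
  convex_univ.norm_image_sub_le_of_norm_fderiv_le (fun x _ => hκ.differentiable f x)
    (fun x _ => hκ.norm_fderiv_le f x) (mem_univ z') (mem_univ z)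

theorem norm_taylor_le (f : V) (z z' : EuclideanSpace ℝ (Fin q)) :
    ‖f z' - f z - fderiv ℝ f z (z' - z)‖ ≤ κ * ‖f‖ * ‖z' - z‖ ^ 2 := by
  rw [pow_two, ← mul_assoc]
  refine (convex_segment z z').norm_image_sub_le_of_norm_hasFDerivWithin_le'
      (fun x _ => (hκ.differentiable f x).hasFDerivAt.hasFDerivWithinAt) (fun x hx => ?_)
      (left_mem_segment ℝ z z') (right_mem_segment ℝ z z')
  exact (hκ.norm_fderiv_sub_le f x z).trans
    (mul_le_mul_of_nonneg_left (norm_sub_le_of_mem_segment hx)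
      (mul_nonneg hκ.nonneg (norm_nonneg _)))

theorem continuous_apply : Continuous fun x : V × EuclideanSpace ℝ (Fin q) => x.1 x.2 :=
  continuous_prod_of_continuous_lipschitzWith _ κ.toNNReal
    (fun f => (hκ.differentiable f).continuous)
    (fun z => LipschitzWith.of_dist_le_mul fun f g => by
      rw [dist_eq_norm, dist_eq_norm, Real.coe_toNNReal _ hκ.nonneg]
      simpa using hκ.norm_le (f - g) z)

theorem continuous_fderiv :
    Continuous fun x : V × EuclideanSpace ℝ (Fin q) => fderiv ℝ (x.1 : _ → _) x.2 :=
  continuous_prod_of_continuous_lipschitzWith _ κ.toNNReal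
    (fun f => (LipschitzWith.of_dist_le_mul (K := (κ * ‖f‖).toNNReal) fun x y => by
      rw [dist_eq_norm, dist_eq_norm,
        Real.coe_toNNReal _ (mul_nonneg hκ.nonneg (norm_nonneg _))]
      exact hκ.norm_fderiv_sub_le f x y).continuous)
    (fun z => LipschitzWith.of_dist_le_mul fun f g => by
      rw [dist_eq_norm, dist_eq_norm, Real.coe_toNNReal _ hκ.nonneg,
        ← fderiv_sub (hκ.differentiable f z) (hκ.differentiable g z)]
      simpa using hκ.norm_fderiv_le (f - g) z)

theorem continuous_kerFun [CompleteSpace V] :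
    Continuous fun x : EuclideanSpace ℝ (Fin q) × EuclideanSpace ℝ (Fin q) =>
      RKHS.kerFun V x.1 x.2 := by
  have h : Continuous fun z : EuclideanSpace ℝ (Fin q) => RKHS.kerFun V z := by
    refine (LipschitzWith.of_dist_le_mul (K := κ.toNNReal) fun z z' => ?_).continuous
    rw [dist_eq_norm, dist_eq_norm, Real.coe_toNNReal _ hκ.nonneg,
      ← LinearIsometryEquiv.norm_map ContinuousLinearMap.adjoint, map_sub]
    refine ContinuousLinearMap.opNorm_le_bound _ (mul_nonneg hκ.nonneg (norm_nonneg _)) fun f => ?_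
    rw [_root_.sub_apply, RKHS.adjoint_kerFun, RKHS.adjoint_kerFun]
    exact (hκ.norm_apply_sub_le f z z').trans_eq (by ring)
  exact (h.comp continuous_fst).clm_apply continuous_snd

theorem aestronglyMeasurable_apply {v : ℝ → V} (hv : AEStronglyMeasurable v timeMeasure)
    {z : ℝ → EuclideanSpace ℝ (Fin q)} (hz : ContinuousOn z (Icc 0 1)) :
    AEStronglyMeasurable (fun t => v t (z t)) timeMeasure :=
  hκ.continuous_apply.comp_aestronglyMeasurable
    (hv.prodMk (hz.aestronglyMeasurable measurableSet_Icc))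

theorem aestronglyMeasurable_fderiv {v : ℝ → V} (hv : AEStronglyMeasurable v timeMeasure)
    {z : ℝ → EuclideanSpace ℝ (Fin q)} (hz : ContinuousOn z (Icc 0 1)) :
    AEStronglyMeasurable (fun t => fderiv ℝ (v t : _ → _) (z t)) timeMeasure :=
  hκ.continuous_fderiv.comp_aestronglyMeasurable
    (hv.prodMk (hz.aestronglyMeasurable measurableSet_Icc))

theorem memLp_apply {v : ℝ → V} (hv : MemLp v 2 timeMeasure)
    {z : ℝ → EuclideanSpace ℝ (Fin q)} (hz : ContinuousOn z (Icc 0 1)) :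
    MemLp (fun t => v t (z t)) 2 timeMeasure :=
  hv.of_le_mul (hκ.aestronglyMeasurable_apply hv.1 hz) (ae_of_all _ fun _ => hκ.norm_le _ _)

end HasRegularFields

end RegularFields

/-! ### Integral equations with coefficients integrable in time -/

section Caratheodory

theorem intervalIntegrable_of_timeMeasure {E : Type*} [NormedAddCommGroup E] {f : ℝ → E}
    (hf : Integrable f timeMeasure) {a b : ℝ} (ha : a ∈ Icc (0 : ℝ) 1) (hb : b ∈ Icc (0 : ℝ) 1) :
    IntervalIntegrable f volume a b :=
  IntegrableOn.intervalIntegrable (IntegrableOn.mono_set hf (uIcc_subset_Icc ha hb))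

variable {E : Type*} [NormedAddCommGroup E] [NormedSpace ℝ E]

theorem continuousOn_integral_from_zero {f : ℝ → E} (hf : Integrable f timeMeasure) :
    ContinuousOn (fun t => ∫ s in (0 : ℝ)..t, f s) (Icc 0 1) := by
  have := intervalIntegral.continuousOn_primitive_interval (μ := volume) (a := (0 : ℝ)) (b := 1)
    (f := f) (by rwa [uIcc_of_le zero_le_one])
  rwa [uIcc_of_le zero_le_one] at this

theorem continuousOn_integral_to_one {f : ℝ → E} (hf : Integrable f timeMeasure) :
    ContinuousOn (fun t => ∫ s in t..(1 : ℝ), f s) (Icc 0 1) := by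
  have := intervalIntegral.continuousOn_primitive_interval_left (μ := volume) (a := (0 : ℝ))
    (b := 1) (f := f) (by rwa [uIcc_of_le zero_le_one])
  rwa [uIcc_of_le zero_le_one] at this

theorem integral_timeMeasure (f : ℝ → E) : ∫ t, f t ∂timeMeasure = ∫ t in (0 : ℝ)..1, f t := by
  rw [integral_Icc_eq_integral_Ioc, intervalIntegral.integral_of_le zero_le_one]

/-- The primitive `t ↦ ∫₀ᵗ k` is only absolutely continuous, but `exp` of it is monotone, and the
integral of the derivative of a monotone function is at most the increment of the function. -/
theorem integral_mul_exp_primitive_le {k : ℝ → ℝ} (hk : Integrable k timeMeasure)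
    (h0 : ∀ s, 0 ≤ k s) {t : ℝ} (ht : t ∈ Icc (0 : ℝ) 1) :
    ∫ s in (0 : ℝ)..t, k s * Real.exp (∫ r in (0 : ℝ)..s, k r)
      ≤ Real.exp (∫ r in (0 : ℝ)..t, k r) - 1 := by
  have h0m : (0 : ℝ) ∈ Icc (0 : ℝ) 1 := ⟨le_rfl, zero_le_one⟩
  set f : ℝ → ℝ := fun s => Real.exp (∫ r in (0 : ℝ)..s, k r) with hf
  have hmono : MonotoneOn f (uIcc 0 t) := by
    rw [uIcc_of_le ht.1]
    intro a ha b hb hab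
    have ha' : a ∈ Icc (0 : ℝ) 1 := ⟨ha.1, ha.2.trans ht.2⟩
    have hb' : b ∈ Icc (0 : ℝ) 1 := ⟨hb.1, hb.2.trans ht.2⟩
    refine Real.exp_le_exp.2 ?_
    rw [← intervalIntegral.integral_add_adjacent_intervals
      (intervalIntegrable_of_timeMeasure hk h0m ha')
      (intervalIntegrable_of_timeMeasure hk ha' hb')]
    have := intervalIntegral.integral_nonneg (μ := volume) hab fun u _ => h0 u
    linarith
  have hmem := hmono.intervalIntegral_deriv_mem_uIcc
  have hf0 : f 0 = 1 := by simp [hf]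
  have hft : f 0 ≤ f t := hmono left_mem_uIcc right_mem_uIcc ht.1
  rw [uIcc_of_le (sub_nonneg.2 hft), hf0] at hmem
  refine le_trans (le_of_eq ?_) hmem.2
  refine intervalIntegral.integral_congr_ae ?_
  filter_upwards [(intervalIntegrable_of_timeMeasure hk h0m ht).ae_hasDerivAt_integral]
    with s hs hst
  have := (hs (uIoc_subset_uIcc hst) 0 left_mem_uIcc).exp
  rw [this.deriv, mul_comm]

/-- A Grönwall inequality with an integrable coefficient. The weight `exp (-2 ∫₀ᵗ k)` in the proof
turns the integral term into half the maximum of the weighted function, which is absorbed in the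
left-hand side; this costs the factors `2` in the bound. -/
theorem le_of_le_add_integral_mul {k u : ℝ → ℝ} {a : ℝ} (hk : Integrable k timeMeasure)
    (h0 : ∀ s, 0 ≤ k s) (hu : ContinuousOn u (Icc 0 1)) (hu0 : ∀ t ∈ Icc (0 : ℝ) 1, 0 ≤ u t)
    (h : ∀ t ∈ Icc (0 : ℝ) 1, u t ≤ a + ∫ s in (0 : ℝ)..t, k s * u s) {t : ℝ}
    (ht : t ∈ Icc (0 : ℝ) 1) :
    u t ≤ 2 * a * Real.exp (∫ s in (0 : ℝ)..1, 2 * k s) := by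
  have h0m : (0 : ℝ) ∈ Icc (0 : ℝ) 1 := ⟨le_rfl, zero_le_one⟩
  have h1m : (1 : ℝ) ∈ Icc (0 : ℝ) 1 := ⟨zero_le_one, le_rfl⟩
  have hk2 : Integrable (fun s => 2 * k s) timeMeasure := hk.const_mul 2
  have h02 : ∀ s, 0 ≤ 2 * k s := fun s => by linarith [h0 s]
  have ha : 0 ≤ a := by simpa using (hu0 0 h0m).trans (h 0 h0m)
  set K : ℝ → ℝ := fun t => ∫ s in (0 : ℝ)..t, 2 * k s with hK
  have hKc : ContinuousOn K (Icc 0 1) := continuousOn_integral_from_zero hk2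
  have hK0 : ∀ t ∈ Icc (0 : ℝ) 1, 0 ≤ K t := fun t ht =>
    intervalIntegral.integral_nonneg ht.1 fun s _ => h02 s
  have hK1 : K t ≤ K 1 := by
    simp only [hK]
    rw [← intervalIntegral.integral_add_adjacent_intervals
      (intervalIntegrable_of_timeMeasure hk2 h0m ht)
      (intervalIntegrable_of_timeMeasure hk2 ht h1m)]
    have := intervalIntegral.integral_nonneg (μ := volume) ht.2 fun u _ => h02 u
    linarith
  -- Let `M` be the maximum of the weighted function `e^{-K} u`, attained at `t₀`.
  obtain ⟨t₀, ht₀, hmax⟩ := isCompact_Icc.exists_isMaxOn (nonempty_Icc.2 zero_le_one)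
    (hKc.neg.rexp.mul hu)
  set M := Real.exp (-K t₀) * u t₀ with hM
  have hM0 : 0 ≤ M := mul_nonneg (Real.exp_pos _).le (hu0 _ ht₀)
  have huM : ∀ s ∈ Icc (0 : ℝ) 1, u s ≤ M * Real.exp (K s) := by
    intro s hs
    have h1 : Real.exp (-K s) * u s ≤ M := hmax hs
    have h2 := mul_le_mul_of_nonneg_right h1 (Real.exp_pos (K s)).le
    have h3 : Real.exp (-K s) * Real.exp (K s) = 1 := by rw [← Real.exp_add]; simp
    calc u s = Real.exp (-K s) * Real.exp (K s) * u s := by rw [h3, one_mul]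
      _ ≤ _ := by linarith
  have hint : ∫ s in (0 : ℝ)..t₀, k s * u s ≤ M / 2 * (Real.exp (K t₀) - 1) := by
    have hle : ∫ s in (0 : ℝ)..t₀, k s * u s
        ≤ ∫ s in (0 : ℝ)..t₀, M / 2 * (2 * k s * Real.exp (K s)) := by
      refine intervalIntegral.integral_mono_on ht₀.1
        (intervalIntegrable_of_timeMeasure (IntegrableOn.mul_continuousOn hk hu isCompact_Icc)
          h0m ht₀)
        (intervalIntegrable_of_timeMeasure ((IntegrableOn.mul_continuousOn hk2 hKc.rexp
          isCompact_Icc).const_mul _) h0m ht₀) fun s hs => ?_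
      have := mul_le_mul_of_nonneg_left (huM s ⟨hs.1, hs.2.trans ht₀.2⟩) (h0 s)
      linarith
    rw [intervalIntegral.integral_const_mul] at hle
    exact hle.trans (mul_le_mul_of_nonneg_left (integral_mul_exp_primitive_le hk2 h02 ht₀)
      (by positivity))
  have hMle : M ≤ 2 * a := by
    have h1 : M * Real.exp (K t₀) = u t₀ := by
      rw [hM, mul_right_comm, ← Real.exp_add]; simp
    have h2 := h t₀ ht₀
    have h3 : 1 ≤ Real.exp (K t₀) := Real.one_le_exp (hK0 _ ht₀)
    have h4 : M / 2 * Real.exp (K t₀) ≤ a * Real.exp (K t₀) := by nlinarith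
    have := le_of_mul_le_mul_right h4 (Real.exp_pos _)
    linarith
  exact (huM t ht).trans (mul_le_mul hMle (Real.exp_le_exp.2 hK1) (Real.exp_pos _).le (by linarith))

/-- Existence for the Carathéodory problem `ẋ_t = g_t(x_t)`, `x_0 = x₀`, with a right-hand side
whose Lipschitz constant is integrable in time. The Picard map is contracting for the norm
weighted by `exp (-2 ∫₀ᵗ k)`; the fixed point below is the solution divided by the weight. -/
theorem exists_eq_add_integral [CompleteSpace E] {g : ℝ → E → E} {k m : ℝ → ℝ}
    (hk : Integrable k timeMeasure)
    (hm : Integrable m timeMeasure) (hk0 : ∀ s, 0 ≤ k s)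
    (hlip : ∀ s x y, ‖g s x - g s y‖ ≤ k s * ‖x - y‖) (hg0 : ∀ s, ‖g s 0‖ ≤ m s)
    (hmeas : ∀ x : ℝ → E, ContinuousOn x (Icc 0 1) →
      AEStronglyMeasurable (fun s => g s (x s)) timeMeasure) (x₀ : E) :
    ∃ x : ℝ → E, ContinuousOn x (Icc 0 1) ∧
      ∀ t ∈ Icc (0 : ℝ) 1, x t = x₀ + ∫ s in (0 : ℝ)..t, g s (x s) := by
  have h0m : (0 : ℝ) ∈ Icc (0 : ℝ) 1 := ⟨le_rfl, zero_le_one⟩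
  have hint : ∀ x : ℝ → E, ContinuousOn x (Icc 0 1) →
      Integrable (fun s => g s (x s)) timeMeasure := by
    intro x hx
    refine (hm.add (IntegrableOn.mul_continuousOn hk hx.norm isCompact_Icc)).mono' (hmeas x hx)
      (ae_of_all _ fun s => ?_)
    have h1 := hlip s (x s) 0
    have h2 := norm_add_le (g s (x s) - g s 0) (g s 0)
    rw [sub_add_cancel] at h2
    rw [sub_zero] at h1
    simp only [Pi.add_apply]
    linarith [hg0 s]
  have hk2 : Integrable (fun s => 2 * k s) timeMeasure := hk.const_mul 2
  have h02 : ∀ s, 0 ≤ 2 * k s := fun s => by linarith [hk0 s]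
  set K : ℝ → ℝ := fun t => ∫ s in (0 : ℝ)..t, 2 * k s with hK
  have hKc : ContinuousOn K (Icc 0 1) := continuousOn_integral_from_zero hk2
  let ext : C(Icc (0 : ℝ) 1, E) → ℝ → E := fun y => IccExtend zero_le_one y
  let X : C(Icc (0 : ℝ) 1, E) → ℝ → E := fun y s => Real.exp (K s) • ext y s
  have hX : ∀ y, ContinuousOn (X y) (Icc 0 1) := fun y =>
    hKc.rexp.smul (y.continuous.Icc_extend' (h := zero_le_one)).continuousOn
  let Ψ : C(Icc (0 : ℝ) 1, E) → C(Icc (0 : ℝ) 1, E) := fun y =>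
    ⟨fun t => Real.exp (-K t) • (x₀ + ∫ s in (0 : ℝ)..t, g s (X y s)),
      continuousOn_iff_continuous_domRestrict.1 (hKc.neg.rexp.smul
        (continuousOn_const.add (continuousOn_integral_from_zero (hint _ (hX y)))))⟩
  have hΨa : ∀ y t ht, Ψ y ⟨t, ht⟩ =
    Real.exp (-K t) • (x₀ + ∫ s in (0 : ℝ)..t, g s (X y s)) := fun _ _ _ => rfl
  have hΨ : ContractingWith (1 / 2) Ψ := by
    refine ⟨by rw [← NNReal.coe_lt_coe]; norm_num, LipschitzWith.of_dist_le_mul fun y y' => ?_⟩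
    refine (ContinuousMap.dist_le (by positivity)).2 fun t => ?_
    obtain ⟨t, ht⟩ := t
    have hd : ‖∫ s in (0 : ℝ)..t, (g s (X y s) - g s (X y' s))‖
        ≤ ∫ s in (0 : ℝ)..t, dist y y' / 2 * (2 * k s * Real.exp (K s)) := by
      refine intervalIntegral.norm_integral_le_of_norm_le ht.1 (ae_of_all _ fun s _ => ?_)
        (intervalIntegrable_of_timeMeasure ((IntegrableOn.mul_continuousOn hk2 hKc.rexp
          isCompact_Icc).const_mul _) h0m ht)
      refine (hlip s _ _).trans ?_
      have h1 : ‖X y s - X y' s‖ ≤ Real.exp (K s) * dist y y' := by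
        simp only [X, ext]
        rw [← smul_sub, norm_smul, Real.norm_of_nonneg (Real.exp_pos _).le, ← dist_eq_norm]
        exact mul_le_mul_of_nonneg_left (ContinuousMap.dist_apply_le_dist _) (Real.exp_pos _).le
      have := mul_le_mul_of_nonneg_left h1 (hk0 s)
      linarith
    rw [intervalIntegral.integral_const_mul, intervalIntegral.integral_sub
      (intervalIntegrable_of_timeMeasure (hint _ (hX y)) h0m ht)
      (intervalIntegrable_of_timeMeasure (hint _ (hX y')) h0m ht)] at hd
    have hw := integral_mul_exp_primitive_le hk2 h02 ht
    have hd0 : 0 ≤ dist y y' := dist_nonneg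
    have he : Real.exp (-K t) * Real.exp (K t) = 1 := by rw [← Real.exp_add]; simp
    have hep := Real.exp_pos (-K t)
    calc dist (Ψ y ⟨t, ht⟩) (Ψ y' ⟨t, ht⟩)
        = Real.exp (-K t) * ‖(∫ s in (0 : ℝ)..t, g s (X y s))
            - ∫ s in (0 : ℝ)..t, g s (X y' s)‖ := by
          rw [hΨa, hΨa, dist_eq_norm, ← smul_sub, norm_smul, Real.norm_of_nonneg hep.le,
            add_sub_add_left_eq_sub]
      _ ≤ Real.exp (-K t) * (dist y y' / 2 * Real.exp (K t)) := by
          refine mul_le_mul_of_nonneg_left (hd.trans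
            (mul_le_mul_of_nonneg_left (hw.trans ?_) (by positivity))) hep.le
          simp only [hK]; linarith
      _ = Real.exp (-K t) * Real.exp (K t) * (dist y y' / 2) := by ring
      _ = _ := by rw [he]; simp; ring
  have hfix : ∃ y, Ψ y = y := ⟨_, hΨ.fixedPoint_isFixedPt⟩
  obtain ⟨y, hy⟩ := hfix
  refine ⟨X y, hX y, fun t ht => ?_⟩
  have h1 : ext y t = Real.exp (-K t) • (x₀ + ∫ s in (0 : ℝ)..t, g s (X y s)) := by
    simp only [ext]
    rw [IccExtend_of_mem _ _ ht]
    exact (DFunLike.congr_fun hy ⟨t, ht⟩).symm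
  change Real.exp (K t) • ext y t = _
  rw [h1, smul_smul, ← Real.exp_add]
  simp

end Caratheodory

/-! ### Integration by parts for primitives of integrable functions -/

section IntegrationByParts

variable {E : Type*} [NormedAddCommGroup E] [InnerProductSpace ℝ E]

theorem integrable_inner_of_continuousOn_left {f g : ℝ → E} (hf : ContinuousOn f (Icc 0 1))
    (hg : Integrable g timeMeasure) : Integrable (fun t => inner ℝ (f t) (g t)) timeMeasure := by
  refine Integrable.mono (IntegrableOn.continuousOn_mul hf.norm hg.norm isCompact_Icc)
    ((hf.aestronglyMeasurable measurableSet_Icc).inner hg.1) (ae_of_all _ fun t => ?_)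
  rw [norm_mul, norm_norm, norm_norm]
  exact norm_inner_le_norm _ _

theorem integrable_inner_of_continuousOn_right {f g : ℝ → E} (hf : Integrable f timeMeasure)
    (hg : ContinuousOn g (Icc 0 1)) : Integrable (fun t => inner ℝ (f t) (g t)) timeMeasure := by
  simpa only [real_inner_comm] using integrable_inner_of_continuousOn_left hg hf

/-- Exchange of the order of integration over the triangle `t ≤ s`. -/
theorem integral_inner_integral_eq [CompleteSpace E] {a b : ℝ → E}
    (ha : Integrable a timeMeasure) (hb : Integrable b timeMeasure) :
    ∫ t, inner ℝ (∫ s in t..(1 : ℝ), a s) (b t) ∂timeMeasure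
      = ∫ s, inner ℝ (a s) (∫ t in (0 : ℝ)..s, b t) ∂timeMeasure := by
  let F : ℝ → ℝ → ℝ := fun t s => {p : ℝ × ℝ | p.1 ≤ p.2}.indicator
    (fun p => inner ℝ (a p.2) (b p.1)) (t, s)
  have hms : MeasurableSet {p : ℝ × ℝ | p.1 ≤ p.2} := measurableSet_le measurable_fst measurable_snd
  have hF : Integrable (Function.uncurry F) (timeMeasure.prod timeMeasure) := by
    refine Integrable.indicator ?_ hms
    refine Integrable.mono (Integrable.mul_prod hb.norm ha.norm)
      (ha.1.comp_snd.inner hb.1.comp_fst) (ae_of_all _ fun p => ?_)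
    rw [norm_mul, norm_norm, norm_norm, mul_comm]
    exact norm_inner_le_norm _ _
  have hleft : ∀ t ∈ Icc (0 : ℝ) 1,
      ∫ s, F t s ∂timeMeasure = inner ℝ (∫ s in t..(1 : ℝ), a s) (b t) := by
    intro t ht
    have hset : Ici t ∩ Icc (0 : ℝ) 1 = Icc t 1 := by
      ext s; simp only [mem_inter_iff, mem_Ici, mem_Icc]; grind
    have h1 : ∀ s, F t s = inner ℝ (b t) ((Ici t).indicator a s) := by
      intro s
      by_cases hs : t ≤ s <;> simp [F, indicator, hs, real_inner_comm]
    simp_rw [h1]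
    rw [integral_inner (ha.indicator measurableSet_Ici), integral_indicator measurableSet_Ici,
      Measure.restrict_restrict measurableSet_Ici, hset,
      integral_Icc_eq_integral_Ioc, ← intervalIntegral.integral_of_le ht.2, real_inner_comm]
  have hright : ∀ s ∈ Icc (0 : ℝ) 1,
      ∫ t, F t s ∂timeMeasure = inner ℝ (a s) (∫ t in (0 : ℝ)..s, b t) := by
    intro s hs
    have hset : Iic s ∩ Icc (0 : ℝ) 1 = Icc 0 s := by
      ext t; simp only [mem_inter_iff, mem_Iic, mem_Icc]; grind
    have h1 : ∀ t, F t s = inner ℝ (a s) ((Iic s).indicator b t) := by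
      intro t
      by_cases ht : t ≤ s <;> simp [F, indicator, ht]
    simp_rw [h1]
    rw [integral_inner (hb.indicator measurableSet_Iic), integral_indicator measurableSet_Iic,
      Measure.restrict_restrict measurableSet_Iic, hset,
      integral_Icc_eq_integral_Ioc, ← intervalIntegral.integral_of_le hs.1]
  rw [← setIntegral_congr_fun measurableSet_Icc hleft, ← setIntegral_congr_fun measurableSet_Icc
    hright]
  exact integral_integral_swap hF

/-- Integration by parts for `P_t = P₁ + ∫ₜ¹ a` and `D_t = ∫₀ᵗ b`. -/
theorem inner_integral_eq_integral_inner_sub [CompleteSpace E]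
    {a b : ℝ → E} (ha : Integrable a timeMeasure) (hb : Integrable b timeMeasure) (P₁ : E) :
    inner ℝ P₁ (∫ s in (0 : ℝ)..1, b s) =
      (∫ t, inner ℝ (P₁ + ∫ s in t..(1 : ℝ), a s) (b t) ∂timeMeasure)
        - ∫ t, inner ℝ (a t) (∫ s in (0 : ℝ)..t, b s) ∂timeMeasure := by
  simp_rw [inner_add_left]
  rw [integral_add (integrable_inner_of_continuousOn_left continuousOn_const hb)
    (integrable_inner_of_continuousOn_left (continuousOn_integral_to_one ha) hb),
    integral_inner_integral_eq ha hb, integral_inner hb, integral_timeMeasure b]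
  ring

end IntegrationByParts

/-! ### The forward and backward problems -/

section FlowEquations

variable {q : ℕ} {V : Type*} [NormedAddCommGroup V] [InnerProductSpace ℝ V]
  [RKHS ℝ V (EuclideanSpace ℝ (Fin q)) (EuclideanSpace ℝ (Fin q))]
  {v w : ℝ → V} {z ζ p p' : ℝ → EuclideanSpace ℝ (Fin q)} {z₀ p₁ : EuclideanSpace ℝ (Fin q)}
  {κ : ℝ}

theorem IsForwardSolution.integrable (hz : IsForwardSolution v z₀ z) :
    Integrable (fun t => v t (z t)) timeMeasure := hz.memLp.integrable one_le_two

theorem IsForwardSolution.continuousOn (hz : IsForwardSolution v z₀ z) :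
    ContinuousOn z (Icc 0 1) :=
  (continuousOn_const.add (continuousOn_integral_from_zero hz.integrable)).congr hz.eq_integral

theorem IsForwardSolution.sub_eq_integral (hz : IsForwardSolution v z₀ z)
    (hζ : IsForwardSolution w z₀ ζ) {t : ℝ} (ht : t ∈ Icc (0 : ℝ) 1) :
    ζ t - z t = ∫ s in (0 : ℝ)..t, (w s (ζ s) - v s (z s)) := by
  have h0m : (0 : ℝ) ∈ Icc (0 : ℝ) 1 := ⟨le_rfl, zero_le_one⟩
  rw [intervalIntegral.integral_sub (intervalIntegrable_of_timeMeasure hζ.integrable h0m ht)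
    (intervalIntegrable_of_timeMeasure hz.integrable h0m ht), hz.eq_integral t ht,
    hζ.eq_integral t ht, add_sub_add_left_eq_sub]

theorem IsBackwardSolution.integrable (hp : IsBackwardSolution v z p₁ p) :
    Integrable (fun t => (fderiv ℝ (⇑(v t)) (z t)).adjoint (p t)) timeMeasure :=
  hp.memLp.integrable one_le_two

theorem IsBackwardSolution.continuousOn (hp : IsBackwardSolution v z p₁ p) :
    ContinuousOn p (Icc 0 1) :=
  (continuousOn_const.add (continuousOn_integral_to_one hp.integrable)).congr hp.eq_integral

theorem measurePreserving_one_sub :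
    MeasurePreserving (fun t : ℝ => 1 - t) timeMeasure timeMeasure := by
  have h := (Measure.measurePreserving_sub_left (volume : Measure ℝ) 1).restrict_preimage
    (measurableSet_Icc (a := (0 : ℝ)) (b := 1))
  have hset : (fun t : ℝ => 1 - t) ⁻¹' Icc 0 1 = Icc 0 1 := by
    ext t; simp only [mem_preimage, mem_Icc]; grind
  rwa [hset] at h

namespace HasRegularFields

theorem norm_adjoint_fderiv_le (hκ : HasRegularFields V κ) (f : V)
    (x y : EuclideanSpace ℝ (Fin q)) :
    ‖(fderiv ℝ f x).adjoint y‖ ≤ κ * ‖f‖ * ‖y‖ := by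
  refine ContinuousLinearMap.le_of_opNorm_le _ ?_ _
  rw [LinearIsometryEquiv.norm_map]
  exact hκ.norm_fderiv_le f x

theorem exists_isForwardSolution (hκ : HasRegularFields V κ) (hv : MemLp v 2 timeMeasure)
    (z₀ : EuclideanSpace ℝ (Fin q)) : ∃ z, IsForwardSolution v z₀ z := by
  have hi : Integrable (fun s => κ * ‖v s‖) timeMeasure :=
    (hv.integrable one_le_two).norm.const_mul κ
  obtain ⟨z, hz, h⟩ := exists_eq_add_integral (g := fun s x => v s x) hi hi
    (fun s => mul_nonneg hκ.nonneg (norm_nonneg _)) (fun s x y => hκ.norm_apply_sub_le (v s) x y)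
    (fun s => hκ.norm_le (v s) 0) (fun x hx => hκ.aestronglyMeasurable_apply hv.1 hx) z₀
  exact ⟨z, hκ.memLp_apply hv hz, h⟩

/-- Stability of the flow with respect to the control, with a Lipschitz constant that depends only
on the reference control `v`. -/
theorem norm_sub_le_integral_norm_sub (hκ : HasRegularFields V κ)
    (hv : MemLp v 2 timeMeasure) (hw : MemLp w 2 timeMeasure)
    (hz : IsForwardSolution v z₀ z) (hζ : IsForwardSolution w z₀ ζ) {t : ℝ}
    (ht : t ∈ Icc (0 : ℝ) 1) :
    ‖ζ t - z t‖ ≤ 2 * (κ * ∫ s in (0 : ℝ)..1, ‖w s - v s‖)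
      * Real.exp (∫ s in (0 : ℝ)..1, 2 * (κ * ‖v s‖)) := by
  have h0m : (0 : ℝ) ∈ Icc (0 : ℝ) 1 := ⟨le_rfl, zero_le_one⟩
  have h1m : (1 : ℝ) ∈ Icc (0 : ℝ) 1 := ⟨zero_le_one, le_rfl⟩
  have hi : Integrable (fun s => κ * ‖v s‖) timeMeasure :=
    (hv.integrable one_le_two).norm.const_mul κ
  have hi' : Integrable (fun s => κ * ‖w s - v s‖) timeMeasure :=
    ((hw.sub hv).integrable one_le_two).norm.const_mul κ
  have hc : ContinuousOn (fun t => ‖ζ t - z t‖) (Icc 0 1) :=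
    (hζ.continuousOn.sub hz.continuousOn).norm
  have hiu : Integrable (fun s => κ * ‖v s‖ * ‖ζ s - z s‖) timeMeasure :=
    IntegrableOn.mul_continuousOn hi hc isCompact_Icc
  refine le_of_le_add_integral_mul hi (fun s => mul_nonneg hκ.nonneg (norm_nonneg _)) hc
    (fun _ _ => norm_nonneg _) (fun t ht => ?_) ht
  have h0 : ∀ s, 0 ≤ κ * ‖w s - v s‖ := fun s => mul_nonneg hκ.nonneg (norm_nonneg _)
  have hmono : ∫ s in (0 : ℝ)..t, κ * ‖w s - v s‖ ≤ κ * ∫ s in (0 : ℝ)..1, ‖w s - v s‖ := by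
    rw [← intervalIntegral.integral_const_mul, ← intervalIntegral.integral_add_adjacent_intervals
      (intervalIntegrable_of_timeMeasure hi' h0m ht) (intervalIntegrable_of_timeMeasure hi' ht h1m)]
    have := intervalIntegral.integral_nonneg (μ := volume) ht.2 fun u _ => h0 u
    linarith
  rw [hz.sub_eq_integral hζ ht]
  calc ‖∫ s in (0 : ℝ)..t, (w s (ζ s) - v s (z s))‖
      ≤ ∫ s in (0 : ℝ)..t, (κ * ‖w s - v s‖ + κ * ‖v s‖ * ‖ζ s - z s‖) := by
        refine intervalIntegral.norm_integral_le_of_norm_le ht.1 (ae_of_all _ fun s _ => ?_)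
          (intervalIntegrable_of_timeMeasure (hi'.add hiu) h0m ht)
        have h1 := hκ.norm_le (w s - v s) (ζ s)
        have h2 := hκ.norm_apply_sub_le (v s) (ζ s) (z s)
        have h3 : w s (ζ s) - v s (z s) = (w s - v s) (ζ s) + (v s (ζ s) - v s (z s)) := by
          rw [RKHS.coe_sub, Pi.sub_apply]; abel
        rw [h3]
        exact (norm_add_le _ _).trans (add_le_add h1 h2)
    _ = (∫ s in (0 : ℝ)..t, κ * ‖w s - v s‖) + ∫ s in (0 : ℝ)..t, κ * ‖v s‖ * ‖ζ s - z s‖ :=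
        intervalIntegral.integral_add (intervalIntegrable_of_timeMeasure hi' h0m ht)
          (intervalIntegrable_of_timeMeasure hiu h0m ht)
    _ ≤ _ := by gcongr

theorem eqOn_of_isForwardSolution (hκ : HasRegularFields V κ) (hv : MemLp v 2 timeMeasure)
    (hz : IsForwardSolution v z₀ z) (hζ : IsForwardSolution v z₀ ζ) : EqOn ζ z (Icc 0 1) := by
  intro t ht
  have := hκ.norm_sub_le_integral_norm_sub hv hv hz hζ ht
  simp only [sub_self, norm_zero, intervalIntegral.integral_zero, mul_zero, zero_mul] at this
  exact sub_eq_zero.1 (norm_le_zero_iff.1 this)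

theorem isForwardSolution_forwardFlow (hκ : HasRegularFields V κ) (hv : MemLp v 2 timeMeasure)
    (z₀ : EuclideanSpace ℝ (Fin q)) : IsForwardSolution v z₀ (forwardFlow v z₀) := by
  have h := hκ.exists_isForwardSolution hv z₀
  rw [forwardFlow, dif_pos h]
  exact h.choose_spec

theorem memLp_adjoint_fderiv_apply (hκ : HasRegularFields V κ) (hv : MemLp v 2 timeMeasure)
    (hz : ContinuousOn z (Icc 0 1)) (hp : ContinuousOn p (Icc 0 1)) :
    MemLp (fun t => (fderiv ℝ (⇑(v t)) (z t)).adjoint (p t)) 2 timeMeasure := by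
  obtain ⟨C, hC⟩ := isCompact_Icc.exists_bound_of_continuousOn hp
  refine hv.of_le_mul (c := κ * C) ?_ ?_
  · have h1 : AEStronglyMeasurable
        (fun t => ContinuousLinearMap.adjoint (fderiv ℝ (⇑(v t)) (z t))) timeMeasure :=
      ContinuousLinearMap.adjoint.continuous.comp_aestronglyMeasurable
        (hκ.aestronglyMeasurable_fderiv hv.1 hz)
    exact isBoundedBilinearMap_apply.continuous.comp_aestronglyMeasurable
      (h1.prodMk (hp.aestronglyMeasurable measurableSet_Icc))
  · refine (ae_restrict_iff' measurableSet_Icc).2 (ae_of_all _ fun t ht => ?_)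
    refine (hκ.norm_adjoint_fderiv_le _ _ _).trans ?_
    have := mul_le_mul_of_nonneg_left (hC t ht) (mul_nonneg hκ.nonneg (norm_nonneg (v t)))
    linarith

/-- The backward problem is solved by reversing time. -/
theorem exists_isBackwardSolution (hκ : HasRegularFields V κ) (hv : MemLp v 2 timeMeasure)
    (hz : ContinuousOn z (Icc 0 1)) (p₁ : EuclideanSpace ℝ (Fin q)) :
    ∃ p, IsBackwardSolution v z p₁ p := by
  have hrev : MapsTo (fun t : ℝ => 1 - t) (Icc 0 1) (Icc 0 1) := fun t ht =>
    ⟨by linarith [ht.2], by linarith [ht.1]⟩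
  have hrevc : ContinuousOn (fun t : ℝ => 1 - t) (Icc 0 1) := by fun_prop
  have hv' : MemLp (fun s => v (1 - s)) 2 timeMeasure :=
    hv.comp_measurePreserving measurePreserving_one_sub
  have hi : Integrable (fun s => κ * ‖v (1 - s)‖) timeMeasure :=
    (hv'.integrable one_le_two).norm.const_mul κ
  obtain ⟨r, hr, h⟩ := exists_eq_add_integral
    (g := fun s x => (fderiv ℝ (⇑(v (1 - s))) (z (1 - s))).adjoint x) hi (integrable_zero _ _ _)
    (fun s => mul_nonneg hκ.nonneg (norm_nonneg _))
    (fun s x y => by rw [← map_sub]; exact hκ.norm_adjoint_fderiv_le _ _ _)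
    (fun s => by simp)
    (fun x hx => (hκ.memLp_adjoint_fderiv_apply hv' (hz.comp hrevc hrev) hx).1) p₁
  have hpc : ContinuousOn (fun t => r (1 - t)) (Icc 0 1) := hr.comp hrevc hrev
  refine ⟨fun t => r (1 - t), ae_of_all _ fun t => hκ.differentiable _ _,
    hκ.memLp_adjoint_fderiv_apply hv hz hpc, fun t ht => ?_⟩
  have := intervalIntegral.integral_comp_sub_left (a := 0) (b := 1 - t)
    (fun s => (fderiv ℝ (⇑(v s)) (z s)).adjoint (r (1 - s))) 1
  simp only [sub_sub_cancel, sub_zero] at this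
  rw [← this]
  exact h (1 - t) (hrev ht)

theorem eqOn_of_isBackwardSolution (hκ : HasRegularFields V κ) (hv : MemLp v 2 timeMeasure)
    (hp : IsBackwardSolution v z p₁ p) (hp' : IsBackwardSolution v z p₁ p') :
    EqOn p' p (Icc 0 1) := by
  have h1m : (1 : ℝ) ∈ Icc (0 : ℝ) 1 := ⟨zero_le_one, le_rfl⟩
  have h0m : (0 : ℝ) ∈ Icc (0 : ℝ) 1 := ⟨le_rfl, zero_le_one⟩
  have hrev : MapsTo (fun t : ℝ => 1 - t) (Icc 0 1) (Icc 0 1) := fun t ht =>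
    ⟨by linarith [ht.2], by linarith [ht.1]⟩
  have hrevc : ContinuousOn (fun t : ℝ => 1 - t) (Icc 0 1) := by fun_prop
  have hv' : MemLp (fun s => v (1 - s)) 2 timeMeasure :=
    hv.comp_measurePreserving measurePreserving_one_sub
  have hi : Integrable (fun s => κ * ‖v (1 - s)‖) timeMeasure :=
    (hv'.integrable one_le_two).norm.const_mul κ
  have hc : ContinuousOn (fun t => ‖p' (1 - t) - p (1 - t)‖) (Icc 0 1) :=
    ((hp'.continuousOn.comp hrevc hrev).sub (hp.continuousOn.comp hrevc hrev)).norm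
  intro t ht
  have key := le_of_le_add_integral_mul (a := 0) hi
    (fun s => mul_nonneg hκ.nonneg (norm_nonneg _)) hc (fun _ _ => norm_nonneg _)
    (fun t ht => ?_) (hrev ht)
  · simp only [sub_sub_cancel, mul_zero, zero_mul] at key
    exact sub_eq_zero.1 (norm_le_zero_iff.1 key)
  have hrt := hrev ht
  have hsub := intervalIntegral.integral_comp_sub_left (a := 0) (b := t)
    (fun s => (fderiv ℝ (⇑(v s)) (z s)).adjoint (p' s - p s)) 1
  rw [sub_zero] at hsub
  rw [hp'.eq_integral _ hrt, hp.eq_integral _ hrt, add_sub_add_left_eq_sub,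
    ← intervalIntegral.integral_sub (intervalIntegrable_of_timeMeasure hp'.integrable hrt h1m)
      (intervalIntegrable_of_timeMeasure hp.integrable hrt h1m), zero_add]
  simp_rw [← map_sub]
  rw [← hsub]
  exact intervalIntegral.norm_integral_le_of_norm_le ht.1
    (ae_of_all _ fun s _ => hκ.norm_adjoint_fderiv_le _ _ _)
    (intervalIntegrable_of_timeMeasure (IntegrableOn.mul_continuousOn hi hc isCompact_Icc) h0m ht)

/-- The variation of the endpoint of the flow, tested against the terminal value of the adjoint
state `p`, is given to first order by the perturbation of the control, evaluated along the
unperturbed trajectory and tested against `p`. The adjoint equation cancels the linear term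
`Dv(z) (ζ - z)`, so that only the Taylor remainder of `v` and the variation of `w - v` between
`z` and `ζ` are left. -/
theorem abs_inner_sub_integral_inner_le (hκ : HasRegularFields V κ)
    (hv : MemLp v 2 timeMeasure) (hw : MemLp w 2 timeMeasure)
    (hz : IsForwardSolution v z₀ z) (hζ : IsForwardSolution w z₀ ζ)
    (hp : IsBackwardSolution v z p₁ p) {C D : ℝ} (hC : ∀ t ∈ Icc (0 : ℝ) 1, ‖p t‖ ≤ C)
    (hD : ∀ t ∈ Icc (0 : ℝ) 1, ‖ζ t - z t‖ ≤ D) :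
    |inner ℝ p₁ (ζ 1 - z 1) - ∫ t, inner ℝ (p t) ((w t - v t) (z t)) ∂timeMeasure|
      ≤ C * (κ * (D ^ 2 * ∫ t in (0 : ℝ)..1, ‖v t‖)
        + κ * (D * ∫ t in (0 : ℝ)..1, ‖w t - v t‖)) := by
  have h1m : (1 : ℝ) ∈ Icc (0 : ℝ) 1 := ⟨zero_le_one, le_rfl⟩
  have hC0 : 0 ≤ C := (norm_nonneg _).trans (hC 1 h1m)
  have hb : Integrable (fun t => w t (ζ t) - v t (z t)) timeMeasure :=
    hζ.integrable.sub hz.integrable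
  have hδ : ContinuousOn (fun t => ζ t - z t) (Icc 0 1) := hζ.continuousOn.sub hz.continuousOn
  have hwv : Integrable (fun t => (w t - v t) (z t)) timeMeasure :=
    (hκ.memLp_apply (hw.sub hv) hz.continuousOn).integrable one_le_two
  have ibp := inner_integral_eq_integral_inner_sub hp.integrable hb p₁
  have e₁ : ∫ t, inner ℝ (p₁ + ∫ s in t..(1 : ℝ), (fderiv ℝ (⇑(v s)) (z s)).adjoint (p s))
      (w t (ζ t) - v t (z t)) ∂timeMeasure
      = ∫ t, inner ℝ (p t) (w t (ζ t) - v t (z t)) ∂timeMeasure :=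
    setIntegral_congr_fun measurableSet_Icc fun t ht => by simp only [hp.eq_integral t ht]
  have e₂ : ∫ t, inner ℝ ((fderiv ℝ (⇑(v t)) (z t)).adjoint (p t))
      (∫ s in (0 : ℝ)..t, (w s (ζ s) - v s (z s))) ∂timeMeasure
      = ∫ t, inner ℝ ((fderiv ℝ (⇑(v t)) (z t)).adjoint (p t)) (ζ t - z t) ∂timeMeasure :=
    setIntegral_congr_fun measurableSet_Icc fun t ht => by
      simp only [hz.sub_eq_integral hζ ht]
  rw [← hz.sub_eq_integral hζ h1m, e₁, e₂] at ibp
  have i₁ := integrable_inner_of_continuousOn_left hp.continuousOn hb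
  have i₂ := integrable_inner_of_continuousOn_right hp.integrable hδ
  have i₁₂ : Integrable (fun t => inner ℝ (p t) (w t (ζ t) - v t (z t))
      - inner ℝ ((fderiv ℝ (⇑(v t)) (z t)).adjoint (p t)) (ζ t - z t)) timeMeasure := i₁.sub i₂
  rw [ibp, ← integral_sub i₁ i₂, ← integral_sub i₁₂
    (integrable_inner_of_continuousOn_left hp.continuousOn hwv), ← Real.norm_eq_abs]
  have hiv : Integrable (fun t => κ * (D ^ 2 * ‖v t‖)) timeMeasure :=
    ((hv.integrable one_le_two).norm.const_mul _).const_mul _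
  have hiw : Integrable (fun t => κ * (D * ‖w t - v t‖)) timeMeasure :=
    (((hw.sub hv).integrable one_le_two).norm.const_mul _).const_mul _
  have hbound : ∀ t ∈ Icc (0 : ℝ) 1,
      ‖inner ℝ (p t) (w t (ζ t) - v t (z t))
        - inner ℝ ((fderiv ℝ (⇑(v t)) (z t)).adjoint (p t)) (ζ t - z t)
        - inner ℝ (p t) ((w t - v t) (z t))‖
      ≤ C * (κ * (D ^ 2 * ‖v t‖) + κ * (D * ‖w t - v t‖)) := by
    intro t ht
    rw [ContinuousLinearMap.adjoint_inner_left, ← inner_sub_right, ← inner_sub_right]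
    have hsplit : w t (ζ t) - v t (z t) - fderiv ℝ (⇑(v t)) (z t) (ζ t - z t) - (w t - v t) (z t)
        = (v t (ζ t) - v t (z t) - fderiv ℝ (⇑(v t)) (z t) (ζ t - z t))
          + ((w t - v t) (ζ t) - (w t - v t) (z t)) := by
      simp only [RKHS.coe_sub, Pi.sub_apply]; abel
    have hDt := hD t ht
    have h1 := hκ.norm_taylor_le (v t) (z t) (ζ t)
    have h2 := hκ.norm_apply_sub_le (w t - v t) (ζ t) (z t)
    have h3 : ‖ζ t - z t‖ ^ 2 ≤ D ^ 2 := by gcongr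
    have h4 := mul_le_mul_of_nonneg_left h3 (mul_nonneg hκ.nonneg (norm_nonneg (v t)))
    have h5 := mul_le_mul_of_nonneg_left hDt (mul_nonneg hκ.nonneg (norm_nonneg (w t - v t)))
    rw [hsplit]
    refine (norm_inner_le_norm _ _).trans (mul_le_mul (hC t ht) ((norm_add_le _ _).trans ?_)
      (norm_nonneg _) hC0)
    linarith
  refine (norm_integral_le_of_norm_le ((hiv.add hiw).const_mul C)
    ((ae_restrict_iff' measurableSet_Icc).2 (ae_of_all _ hbound))).trans_eq ?_
  simp only [Pi.add_apply]
  rw [integral_const_mul, integral_add hiv hiw, integral_const_mul, integral_const_mul,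
    integral_const_mul, integral_const_mul, integral_timeMeasure, integral_timeMeasure]

end HasRegularFields

end FlowEquations

/-! ### First order expansion of the endpoint of the flow -/

section EndpointExpansion

theorem integral_norm_sub_le {V : Type*} [NormedAddCommGroup V] (w v : Control V) :
    ∫ t in (0 : ℝ)..1, ‖w t - v t‖ ≤ ‖w - v‖ := by
  have : IsProbabilityMeasure timeMeasure := ⟨by simp⟩
  have hae : (fun t => ‖w t - v t‖) =ᵐ[timeMeasure] fun t => ‖(w - v) t‖ := by
    filter_upwards [Lp.coeFn_sub w v] with t ht
    rw [ht, Pi.sub_apply]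
  rw [← integral_timeMeasure, integral_congr_ae hae, Lp.norm_def,
    integral_norm_eq_lintegral_enorm (Lp.aestronglyMeasurable _), ← eLpNorm_one_eq_lintegral_enorm]
  exact ENNReal.toReal_mono (Lp.eLpNorm_ne_top _)
    (eLpNorm_le_eLpNorm_of_exponent_le one_le_two (Lp.aestronglyMeasurable _))

variable {q : ℕ} {V : Type*} [NormedAddCommGroup V] [InnerProductSpace ℝ V]
  [RKHS ℝ V (EuclideanSpace ℝ (Fin q)) (EuclideanSpace ℝ (Fin q))]
  {v : Control V} {z p : ℝ → EuclideanSpace ℝ (Fin q)} {z₀ p₁ : EuclideanSpace ℝ (Fin q)} {κ : ℝ}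

/-- First order expansion of the endpoint of the flow at a control `v`, with a quadratic remainder:
the constant is uniform over all controls `w`, close to `v` or not. -/
theorem HasRegularFields.exists_quadratic_bound (hκ : HasRegularFields V κ)
    (hz : IsForwardSolution v z₀ z) (hp : IsBackwardSolution v z p₁ p) :
    ∃ C, 0 ≤ C ∧ ∀ w : Control V, ‖forwardFlow w z₀ 1 - z 1‖ ^ 2 ≤ C * ‖w - v‖ ^ 2 ∧
      |inner ℝ p₁ (forwardFlow w z₀ 1 - z 1)
        - ∫ t, inner ℝ (p t) ((w t - v t) (z t)) ∂timeMeasure| ≤ C * ‖w - v‖ ^ 2 := by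
  have h1m : (1 : ℝ) ∈ Icc (0 : ℝ) 1 := ⟨zero_le_one, le_rfl⟩
  have hκ0 := hκ.nonneg
  obtain ⟨P, hP⟩ := isCompact_Icc.exists_bound_of_continuousOn hp.continuousOn
  have hP0 : 0 ≤ P := (norm_nonneg _).trans (hP 1 h1m)
  set R := Real.exp (∫ s in (0 : ℝ)..1, 2 * (κ * ‖v s‖)) with hR
  set I := ∫ t in (0 : ℝ)..1, ‖v t‖ with hI
  have hR0 : 0 ≤ R := (Real.exp_pos _).le
  have hI0 : 0 ≤ I := intervalIntegral.integral_nonneg zero_le_one fun _ _ => norm_nonneg _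
  -- `S` is the Lipschitz constant of the trajectories with respect to the control.
  set S := 2 * κ * R with hS
  have hS0 : 0 ≤ S := by positivity
  refine ⟨S ^ 2 + P * (κ * (S ^ 2 * I) + κ * S), by positivity, fun w => ?_⟩
  have hζ := hκ.isForwardSolution_forwardFlow (Lp.memLp w) z₀
  set η := ‖w - v‖ with hη
  have hη0 : 0 ≤ η := norm_nonneg _
  have hJ := integral_norm_sub_le w v
  have hD : ∀ t ∈ Icc (0 : ℝ) 1, ‖forwardFlow w z₀ t - z t‖ ≤ S * η := by
    intro t ht
    refine (hκ.norm_sub_le_integral_norm_sub (Lp.memLp v) (Lp.memLp w) hz hζ ht).trans ?_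
    have := mul_le_mul_of_nonneg_left hJ hS0
    calc _ = S * ∫ t in (0 : ℝ)..1, ‖w t - v t‖ := by rw [hS]; ring
      _ ≤ _ := this
  have hrest : 0 ≤ P * (κ * (S ^ 2 * I) + κ * S) * η ^ 2 := by positivity
  constructor
  · have := pow_le_pow_left₀ (norm_nonneg _) (hD 1 h1m) 2
    nlinarith
  · refine (hκ.abs_inner_sub_integral_inner_le (Lp.memLp v) (Lp.memLp w) hz hζ hp hP hD).trans ?_
    have h2 : S * η * ∫ t in (0 : ℝ)..1, ‖w t - v t‖ ≤ S * η * η :=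
      mul_le_mul_of_nonneg_left hJ (by positivity)
    calc _ ≤ P * (κ * ((S * η) ^ 2 * I) + κ * (S * η * η)) := by gcongr
      _ = P * (κ * (S ^ 2 * I) + κ * S) * η ^ 2 := by ring
      _ ≤ _ := by nlinarith [mul_nonneg (sq_nonneg S) (sq_nonneg η)]

end EndpointExpansion

/-! ### The gradient of the empirical risk -/

section Gradient

variable {q : ℕ} {V : Type*} [NormedAddCommGroup V] [InnerProductSpace ℝ V] [CompleteSpace V]
  [RKHS ℝ V (EuclideanSpace ℝ (Fin q)) (EuclideanSpace ℝ (Fin q))] {κ : ℝ}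

theorem inner_toEuclideanLin_transpose {m n : ℕ} (B : Matrix (Fin m) (Fin n) ℝ)
    (x : EuclideanSpace ℝ (Fin m)) (y : EuclideanSpace ℝ (Fin n)) :
    inner ℝ (B.transpose.toEuclideanLin x) y = inner ℝ x (B.toEuclideanLin y) := by
  rw [← Matrix.conjTranspose_eq_transpose_of_trivial,
    Matrix.toEuclideanLin_conjTranspose_eq_adjoint, LinearMap.adjoint_inner_left]

theorem HasRegularFields.memLp_neg_sum_kerFun (hκ : HasRegularFields V κ) {N : ℕ}
    {z p : Fin N → ℝ → EuclideanSpace ℝ (Fin q)} (hz : ∀ i, ContinuousOn (z i) (Icc 0 1))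
    (hp : ∀ i, ContinuousOn (p i) (Icc 0 1)) :
    MemLp (fun t => -∑ i, RKHS.kerFun V (z i t) (p i t)) 2 timeMeasure := by
  have hc : ContinuousOn (fun t => -∑ i, RKHS.kerFun V (z i t) (p i t)) (Icc 0 1) :=
    (continuousOn_finsetSum _ fun i _ =>
      hκ.continuous_kerFun.comp_continuousOn ((hz i).prodMk (hp i))).neg
  obtain ⟨C, hC⟩ := isCompact_Icc.exists_bound_of_continuousOn hc
  exact MemLp.of_bound (hc.aestronglyMeasurable measurableSet_Icc) C
    ((ae_restrict_iff' measurableSet_Icc).2 (ae_of_all _ hC))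

/-- The reproducing property, integrated in time. -/
theorem HasRegularFields.inner_toLp_neg_sum_kerFun (hκ : HasRegularFields V κ) {N : ℕ}
    {z p : Fin N → ℝ → EuclideanSpace ℝ (Fin q)} (hz : ∀ i, ContinuousOn (z i) (Icc 0 1))
    (hp : ∀ i, ContinuousOn (p i) (Icc 0 1))
    (hG : MemLp (fun t => -∑ i, RKHS.kerFun V (z i t) (p i t)) 2 timeMeasure) (w v : Control V) :
    inner ℝ (hG.toLp _) (w - v)
      = -∑ i, ∫ t, inner ℝ (p i t) ((w t - v t) (z i t)) ∂timeMeasure := by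
  have hae : (fun t => inner ℝ (hG.toLp _ t) ((w - v) t)) =ᵐ[timeMeasure]
      fun t => -∑ i, inner ℝ (p i t) ((w t - v t) (z i t)) := by
    filter_upwards [hG.coeFn_toLp, Lp.coeFn_sub w v] with t h1 h2
    rw [h1, h2, inner_neg_left, sum_inner]
    simp only [RKHS.kerFun_inner, Pi.sub_apply]
  rw [L2.inner_def, integral_congr_ae hae, integral_neg, integral_finsetSum _ fun i _ => ?_]
  exact integrable_inner_of_continuousOn_left (hp i)
    ((hκ.memLp_apply ((Lp.memLp w).sub (Lp.memLp v)) (hz i)).integrable one_le_two)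

/-- With adjoint states of terminal value `p_1 = -(1/N) Bᵀ (B z_1 - y)`, the linear part of the term
of each sample in the risk is `-⟨p_1, ζ_1 - z_1⟩`, so the remainder of the risk is a sum of
quadratic terms. -/
theorem HasRegularFields.hasGradientAt_empiricalRisk (hκ : HasRegularFields V κ) {d d' N : ℕ}
    (A : Matrix (Fin q) (Fin d) ℝ) (B : Matrix (Fin d') (Fin q) ℝ)
    (x : Fin N → EuclideanSpace ℝ (Fin d)) (y : Fin N → EuclideanSpace ℝ (Fin d'))
    (v : Control V) {z p : Fin N → ℝ → EuclideanSpace ℝ (Fin q)}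
    (hz : ∀ i, z i = forwardFlow v (A.toEuclideanLin (x i)))
    (hp : ∀ i, IsBackwardSolution v (z i)
      (-(1 / (N : ℝ)) • B.transpose.toEuclideanLin (B.toEuclideanLin (z i 1) - y i)) (p i))
    (hG : MemLp (fun t => -∑ i, RKHS.kerFun V (z i t) (p i t)) 2 timeMeasure) :
    HasGradientAt (empiricalRisk (V := V) A B x y) (hG.toLp _) v := by
  have hfwd : ∀ i, IsForwardSolution v (A.toEuclideanLin (x i)) (z i) := fun i => by
    rw [hz i]; exact hκ.isForwardSolution_forwardFlow (Lp.memLp v) _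
  choose C hC0 hC1 hC2 using fun i => hκ.exists_quadratic_bound (hfwd i) (hp i)
  set b := ‖(B.toEuclideanLin).toContinuousLinearMap‖ with hb
  have hBle : ∀ u, ‖B.toEuclideanLin u‖ ≤ b * ‖u‖ := fun u =>
    (B.toEuclideanLin).toContinuousLinearMap.le_opNorm u
  have key : ∀ w : Control V,
      ‖empiricalRisk A B x y w - empiricalRisk A B x y v - inner ℝ (hG.toLp _) (w - v)‖
        ≤ (∑ i, (1 / (2 * (N : ℝ)) * b ^ 2 * C i + C i)) * ‖w - v‖ ^ 2 := by
    intro w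
    set δ : Fin N → EuclideanSpace ℝ (Fin q) := fun i =>
      forwardFlow w (A.toEuclideanLin (x i)) 1 - z i 1 with hδ
    have hexp : empiricalRisk A B x y w - empiricalRisk A B x y v - inner ℝ (hG.toLp _) (w - v)
        = ∑ i, (1 / (2 * (N : ℝ)) * ‖B.toEuclideanLin (δ i)‖ ^ 2
          - (inner ℝ (-(1 / (N : ℝ)) •
              B.transpose.toEuclideanLin (B.toEuclideanLin (z i 1) - y i)) (δ i)
            - ∫ t, inner ℝ (p i t) ((w t - v t) (z i t)) ∂timeMeasure)) := by
      rw [hκ.inner_toLp_neg_sum_kerFun (fun i => (hfwd i).continuousOn)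
        (fun i => (hp i).continuousOn), empiricalRisk, empiricalRisk, Finset.mul_sum,
        Finset.mul_sum, ← Finset.sum_sub_distrib, sub_neg_eq_add, ← Finset.sum_add_distrib]
      refine Finset.sum_congr rfl fun i _ => ?_
      have h1 : output A B w (x i) - y i
          = (B.toEuclideanLin (z i 1) - y i) + B.toEuclideanLin (δ i) := by
        rw [output, hδ, map_sub]; abel
      have h2 : output A B v (x i) = B.toEuclideanLin (z i 1) := by rw [output, hz i]
      rw [h1, h2, norm_add_sq_real, inner_smul_left, inner_toEuclideanLin_transpose]
      simp only [conj_trivial]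
      have h3 : 1 / (2 * (N : ℝ)) = 1 / (N : ℝ) / 2 := by rw [div_div, mul_comm]
      rw [h3]
      ring
    rw [hexp, Finset.sum_mul]
    refine norm_sum_le_of_le _ fun i _ => ?_
    have h1 : ‖B.toEuclideanLin (δ i)‖ ^ 2 ≤ b ^ 2 * (C i * ‖w - v‖ ^ 2) :=
      calc ‖B.toEuclideanLin (δ i)‖ ^ 2 ≤ (b * ‖δ i‖) ^ 2 := by gcongr; exact hBle _
        _ = b ^ 2 * ‖δ i‖ ^ 2 := mul_pow _ _ _
        _ ≤ _ := by gcongr; exact hC1 i w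
    have h2 : ‖1 / (2 * (N : ℝ)) * ‖B.toEuclideanLin (δ i)‖ ^ 2‖
        ≤ 1 / (2 * (N : ℝ)) * (b ^ 2 * (C i * ‖w - v‖ ^ 2)) := by
      rw [Real.norm_of_nonneg (by positivity)]
      gcongr
    refine (_root_.norm_sub_le _ _).trans ((add_le_add h2 (hC2 i w)).trans_eq (by ring))
  refine hasGradientAt_iff_isLittleO.2 ((Asymptotics.IsBigO.of_bound
    (∑ i, (1 / (2 * (N : ℝ)) * b ^ 2 * C i + C i)) (g := fun w => ‖w - v‖ ^ 2)
    (Filter.Eventually.of_forall fun w => ?_)).trans_isLittleO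
    ((Asymptotics.isLittleO_norm_pow_id one_lt_two).comp_tendsto
      (tendsto_sub_nhds_zero_iff.2 Filter.tendsto_id)))
  rw [Real.norm_of_nonneg (by positivity : 0 ≤ ‖w - v‖ ^ 2)]
  exact key w

end Gradient

end FlowResNet

theorem mainTheorem7 {q d d' N : ℕ} {V : Type*} [NormedAddCommGroup V] [InnerProductSpace ℝ V]
    [CompleteSpace V] [RKHS ℝ V (EuclideanSpace ℝ (Fin q)) (EuclideanSpace ℝ (Fin q))]
    (hV : FlowResNet.IsStronglyAdmissible V)
    (A : Matrix (Fin q) (Fin d) ℝ) (B : Matrix (Fin d') (Fin q) ℝ)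
    (x : Fin N → EuclideanSpace ℝ (Fin d)) (y : Fin N → EuclideanSpace ℝ (Fin d')) :
    Differentiable ℝ (FlowResNet.empiricalRisk (V := V) A B x y) ∧
    ∀ v : FlowResNet.Control V,
      ∃ z p : Fin N → ℝ → EuclideanSpace ℝ (Fin q),
        -- `z i` is the unique solution of the forward problem started at `A (x i)`
        (∀ i, FlowResNet.IsForwardSolution (v : ℝ → V) (A.toEuclideanLin (x i)) (z i) ∧
          ∀ z', FlowResNet.IsForwardSolution (v : ℝ → V) (A.toEuclideanLin (x i)) z' →
            EqOn z' (z i) (Icc 0 1)) ∧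
        -- `p i` is the unique solution of the backward problem along `z i`
        (∀ i, FlowResNet.IsBackwardSolution (v : ℝ → V) (z i)
            (-(1 / (N : ℝ)) • B.transpose.toEuclideanLin (B.toEuclideanLin (z i 1) - y i)) (p i) ∧
          ∀ p', FlowResNet.IsBackwardSolution (v : ℝ → V) (z i)
            (-(1 / (N : ℝ)) • B.transpose.toEuclideanLin (B.toEuclideanLin (z i 1) - y i)) p' →
            EqOn p' (p i) (Icc 0 1)) ∧
        -- the gradient is `t ↦ - ∑ i, K(·, z i t) (p i t)`
        ∃ hG : MemLp (fun t => -∑ i, RKHS.kerFun V (z i t) (p i t)) 2 FlowResNet.timeMeasure,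
          HasGradientAt (FlowResNet.empiricalRisk (V := V) A B x y) (hG.toLp _) v := by
  obtain ⟨κ, hκ⟩ := hV.exists_hasRegularFields
  -- Differentiability follows from the existence of the gradient at every control.
  refine (and_iff_right_of_imp fun h v => ?_).2 fun v => ?_
  · obtain ⟨z, p, -, -, hG, hgrad⟩ := h v
    exact hgrad.differentiableAt
  have hv : MemLp (v : ℝ → V) 2 FlowResNet.timeMeasure := Lp.memLp v
  let z : Fin N → ℝ → EuclideanSpace ℝ (Fin q) := fun i =>
    FlowResNet.forwardFlow v (A.toEuclideanLin (x i))
  have hz : ∀ i, FlowResNet.IsForwardSolution (v : ℝ → V) (A.toEuclideanLin (x i)) (z i) :=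
    fun i => hκ.isForwardSolution_forwardFlow hv _
  choose p hp using fun i => hκ.exists_isBackwardSolution hv (hz i).continuousOn
    (-(1 / (N : ℝ)) • B.transpose.toEuclideanLin (B.toEuclideanLin (z i 1) - y i))
  have hG := hκ.memLp_neg_sum_kerFun (fun i => (hz i).continuousOn) fun i => (hp i).continuousOn
  exact ⟨z, p, fun i => ⟨hz i, fun z' hz' => hκ.eqOn_of_isForwardSolution hv (hz i) hz'⟩,
    fun i => ⟨hp i, fun p' hp' => hκ.eqOn_of_isBackwardSolution hv (hp i) hp'⟩,
    hG, hκ.hasGradientAt_empiricalRisk A B x y v (fun _ => rfl) hp hG⟩
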